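/- Let $P\subset\mathbb{R}^2$ be a convex polygon with vertices $A_1,\dots,A_n$ ($n\ge 3$) and smallest vertex angle $\theta_{\min}$. Let $\mathcal S=\{S_1,\dots,S_m\}$ be a system of contracting similarities of $\mathbb{R}^2$ (that is, $|S_i(x)-S_i(y)|=r_i|x-y|$ for all $x,y$, with $0<r_i<1$) such that $(P,\mathcal S)$ is a polygonal tree system, i.e., writing $P_i=S_i(P)$: (D1) $P_i\subset P$ for every $i$; (D2) for $i\ne j$, $P_i\cap P_j$ is either empty or consists of a single point that is a common vertex of $P_i$ and $P_j$; (D3) every vertex $A_k$ of $P$ lies in some $P_i$; (D4) $\bigcup_{i=1}^m P_i$ is contractible. Let $K$ be the attractor of $\mathcal S$, i.e. the nonempty compact set with $K=\bigcup_{i=1}^m S_i(K)$, let $I=\{1,\dots,m\}$, and let $\pi:I^{\infty}\to K$ be the address map, $\{\pi(\alpha)\}=\bigcap_{k} S_{\alpha_1}\cdots S_{\alpha_k}(K)$. Then: (i) for every $x\in K$, the set $\pi^{-1}(x)$ is finite and has at most $$(n-1)\left(\left\lceil \frac{2\pi}{\theta_{\min}}\right\rceil-1\right)$$ elements (in this formula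 $\pi$ is the number); (ii) the system $\mathcal S$ is post-critically finite: if $\mathcal C=\bigcup_{i\neq j}S_i(K)\cap S_j(K)$ is the critical set, then the post-critical set, consisting of all $\alpha\in I^{\infty}$ such that $S_{j_1}\cdots S_{j_k}(\pi(\alpha))\in\mathcal C$ for some finite word $j_1\dots j_k$ with $k\ge 1$ and letters in $I$, is finite. -/

import Mathlib

namespace PolygonalTree

/-- The Euclidean plane. -/
abbrev Plane : Type := EuclideanSpace ℝ (Fin 2)

section Polygons

variable {n : ℕ} [NeZero n]

/-- The vertices of `P`, listed in cyclic order (either orientation), are the vertices of a convex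
polygon with `n ≥ 3` corners: for each side, all the remaining vertices lie strictly on one and the
same side of the line through it. Indices are read modulo `n`. -/
def IsConvexPolygon (P : Polygon Plane n) : Prop :=
  3 ≤ n ∧ ∀ i j k : Fin n, j ≠ i → j ≠ i + 1 → k ≠ i → k ≠ i + 1 →
    (affineSpan ℝ {P i, P (i + 1)}).SSameSide (P j) (P k)

/-- The closed region of the plane occupied by a convex polygon. -/
def region (P : Polygon Plane n) : Set Plane :=
  convexHull ℝ (Set.range P.vertices)

/-- The interior angle of a convex polygon at its vertex `P i`. -/
noncomputable def vertexAngle (P : Polygon Plane n) (i : Fin n) : ℝ :=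
  EuclideanGeometry.angle (P (i - 1)) (P i) (P (i + 1))

/-- The smallest vertex angle (a minimum over finitely many vertices). -/
noncomputable def minAngle (P : Polygon Plane n) : ℝ :=
  ⨅ i : Fin n, vertexAngle P i

end Polygons

section Systems

variable {m : ℕ}

/-- A contracting similarity of the plane. -/
def IsContractingSimilarity (f : Plane → Plane) : Prop :=
  ∃ r : ℝ, 0 < r ∧ r < 1 ∧ ∀ x y, dist (f x) (f y) = r * dist x y

/-- A polygonal tree system associated with a convex polygon `P`. -/
structure IsPolygonalTreeSystem {n : ℕ} [NeZero n] (P : Polygon Plane n)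
    (S : Fin m → Plane → Plane) : Prop where
  convex : IsConvexPolygon P
  similarity : ∀ i, IsContractingSimilarity (S i)
  image_subset : ∀ i, S i '' region P ⊆ region P
  inter : ∀ i j, i ≠ j → S i '' region P ∩ S j '' region P = ∅ ∨
    ∃ k l, S i (P k) = S j (P l) ∧ S i '' region P ∩ S j '' region P = {S i (P k)}
  vertex_mem : ∀ k, ∃ i, P k ∈ S i '' region P
  contractible : ContractibleSpace (⋃ i, S i '' region P : Set Plane)

/-- `K` is the attractor of `S`: the nonempty compact set with `K = S₁(K) ∪ ⋯ ∪ Sₘ(K)`. -/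
structure IsAttractor (S : Fin m → Plane → Plane) (K : Set Plane) : Prop where
  nonempty : K.Nonempty
  compact : IsCompact K
  invariant : K = ⋃ i, S i '' K

/-- `S_j = S_{j₁} ∘ ⋯ ∘ S_{jₖ}` for a finite word `j = j₁ … jₖ` (the identity for the empty
word). -/
def wordMap (S : Fin m → Plane → Plane) : List (Fin m) → Plane → Plane
  | [] => id
  | i :: w => S i ∘ wordMap S w

/-- The word formed by the first `k` letters of an infinite sequence. -/
def initialWord (α : ℕ → Fin m) (k : ℕ) : List (Fin m) :=
  List.ofFn fun t : Fin k => α t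

/-- The address map `π`: for the attractor `K` of a system of contracting similarities, `π α` is the
unique point of `⋂ₖ S_{α₁ … αₖ}(K)`; see `iInter_eq_singleton_addressMap`. -/
noncomputable def addressMap (S : Fin m → Plane → Plane) (K : Set Plane) (α : ℕ → Fin m) : Plane :=
  Classical.epsilon fun x => ∀ k, x ∈ wordMap S (initialWord α k) '' K

/-- The critical set: the union of all `S_i(K) ∩ S_j(K)` with `i ≠ j`. -/
def criticalSet (S : Fin m → Plane → Plane) (K : Set Plane) : Set Plane :=
  {x | ∃ i j, i ≠ j ∧ x ∈ S i '' K ∩ S j '' K}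

/-- The post-critical set: all infinite sequences `α` such that `S_w (π α)` is critical for some
finite (nonempty) word `w`. -/
def postCriticalSet (S : Fin m → Plane → Plane) (K : Set Plane) : Set (ℕ → Fin m) :=
  {α | ∃ w : List (Fin m), w ≠ [] ∧ wordMap S w (addressMap S K α) ∈ criticalSet S K}

/-- Post-critical finiteness. -/
def IsPostCriticallyFinite (S : Fin m → Plane → Plane) (K : Set Plane) : Prop :=
  (postCriticalSet S K).Finite

theorem initialWord_succ (α : ℕ → Fin m) (k : ℕ) :
    initialWord α (k + 1) = initialWord α k ++ [α k] := by
  rw [initialWord, List.ofFn_succ_last]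
  rfl

theorem wordMap_append (S : Fin m → Plane → Plane) (v w : List (Fin m)) :
    wordMap S (v ++ w) = wordMap S v ∘ wordMap S w := by
  induction v with
  | nil => rfl
  | cons i v ih => simp [wordMap, ih, Function.comp_assoc]

theorem exists_ratio {S : Fin m → Plane → Plane} (hS : ∀ i, IsContractingSimilarity (S i)) :
    ∃ q : ℝ, 0 ≤ q ∧ q < 1 ∧ ∀ (w : List (Fin m)) (x y : Plane),
      dist (wordMap S w x) (wordMap S w y) ≤ q ^ w.length * dist x y := by
  choose r hr0 hr1 hr using hS
  obtain ⟨q, hq0, hq1, hq⟩ : ∃ q : ℝ, 0 ≤ q ∧ q < 1 ∧ ∀ i, r i ≤ q := by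
    rcases isEmpty_or_nonempty (Fin m) with h | h
    · exact ⟨0, le_rfl, one_pos, fun i => h.elim i⟩
    · obtain ⟨i, hi⟩ := Finite.exists_max r
      exact ⟨r i, (hr0 i).le, hr1 i, hi⟩
  refine ⟨q, hq0, hq1, fun w x y => ?_⟩
  induction w with
  | nil => simp [wordMap]
  | cons i w ih =>
    calc dist (wordMap S (i :: w) x) (wordMap S (i :: w) y)
        = r i * dist (wordMap S w x) (wordMap S w y) := hr i _ _
      _ ≤ q * (q ^ w.length * dist x y) := mul_le_mul (hq i) ih dist_nonneg hq0
      _ = q ^ (i :: w).length * dist x y := by rw [List.length_cons, pow_succ]; ring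

/-- The address map is well defined. -/
theorem iInter_eq_singleton_addressMap {S : Fin m → Plane → Plane} {K : Set Plane}
    (hS : ∀ i, IsContractingSimilarity (S i)) (hK : IsAttractor S K) (α : ℕ → Fin m) :
    ⋂ k, wordMap S (initialWord α k) '' K = {addressMap S K α} := by
  obtain ⟨q, hq0, hq1, hq⟩ := exists_ratio hS
  have hcont : ∀ w, Continuous (wordMap S w) := fun w =>
    (LipschitzWith.of_dist_le_mul (K := ⟨q ^ w.length, pow_nonneg hq0 _⟩)
      fun x y => hq w x y).continuous
  have hcomp : ∀ k, IsCompact (wordMap S (initialWord α k) '' K) := fun k =>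
    hK.compact.image (hcont _)
  have hne : (⋂ k, wordMap S (initialWord α k) '' K).Nonempty := by
    refine IsCompact.nonempty_iInter_of_sequence_nonempty_isCompact_isClosed _ (fun k => ?_)
      (fun k => hK.nonempty.image _) (hcomp 0) (fun k => (hcomp k).isClosed)
    rw [initialWord_succ, wordMap_append, Set.image_comp]
    refine Set.image_mono ?_
    conv_rhs => rw [hK.invariant]
    exact Set.subset_iUnion (fun i => S i '' K) (α k)
  obtain ⟨x, hx⟩ := hne
  have hspec : ∀ k, addressMap S K α ∈ wordMap S (initialWord α k) '' K :=
    Classical.epsilon_spec (p := fun x => ∀ k, x ∈ wordMap S (initialWord α k) '' K)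
      ⟨x, fun k => Set.mem_iInter.1 hx k⟩
  refine Set.eq_singleton_iff_unique_mem.2 ⟨Set.mem_iInter.2 hspec, fun y hy => ?_⟩
  have hle : ∀ k : ℕ, dist y (addressMap S K α) ≤ q ^ k * Metric.diam K := by
    intro k
    obtain ⟨a, ha, hay⟩ := Set.mem_iInter.1 hy k
    obtain ⟨b, hb, hab⟩ := hspec k
    rw [← hay, ← hab]
    refine (hq _ a b).trans ?_
    have hlen : (initialWord α k).length = k := by simp [initialWord]
    rw [hlen]
    exact mul_le_mul_of_nonneg_left (Metric.dist_le_diam_of_mem hK.compact.isBounded ha hb)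
      (pow_nonneg hq0 _)
  have hlim : Filter.Tendsto (fun k : ℕ => q ^ k * Metric.diam K) Filter.atTop (nhds 0) := by
    simpa using (tendsto_pow_atTop_nhds_zero_of_lt_one hq0 hq1).mul_const (Metric.diam K)
  exact dist_le_zero.1 (ge_of_tendsto' hlim hle)

end Systems

end PolygonalTree

/-!
The vertices of a convex polygon are its extreme points, and a similarity is affine. So when an
image `S_w(P) ⊆ P` contains a vertex of `P`, that vertex is the image of a vertex
(`IsConvexPolygon.eq_vertex_of_map_eq_vertex`). Together with the condition that two pieces of the
first generation meet at most in a common vertex, induction on the length of words shows that two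
distinct pieces `S_v(P)`, `S_w(P)` of the same generation have at most one common point, and that
such a point is a corner of both (`IsPolygonalTreeSystem.inter_pieces`).

Suppose that a point `x` has several addresses. Their initial words of some common length are
distinct, and the corresponding pieces all have a corner at `x`. Near `x` each of these pieces
fills a sector of opening at least `θ`, the smallest vertex angle, and these sectors do not
overlap. Hence the bisectors of any two of them differ by at least `θ`, and there are at most
`⌈2π / θ⌉` of them (`IsPolygonalTreeSystem.card_corners_le`). This bound on the number of addresses
does not exceed the claimed one, because `⌈2π / θ⌉ ≥ 2` and `n ≥ 3`.

If `α` is post-critical, then `S_w(π(α))` lies in two pieces of the first generation for some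
nonempty word `w`, and therefore is a corner of the piece given by the first letter of `w`. By
extremality `π(α)` is a vertex of `P` (`IsPolygonalTreeSystem.exists_addressMap_eq_vertex`). So the
post-critical set consists of addresses of the finitely many vertices, each of which has finitely
many.
-/

namespace PolygonalTree

/-! ### Sectors of the plane -/

/-- The determinant of two vectors of the plane. -/
def cross (u v : Plane) : ℝ := u 0 * v 1 - u 1 * v 0

/-- The unit vector of the plane with polar angle `φ`. -/
noncomputable def direction (φ : ℝ) : Plane := !₂[Real.cos φ, Real.sin φ]

theorem direction_ne_zero (φ : ℝ) : direction φ ≠ 0 := by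
  intro h
  have h0 : Real.cos φ = 0 := by simpa [direction] using congrArg (fun v : Plane => v 0) h
  have h1 : Real.sin φ = 0 := by simpa [direction] using congrArg (fun v : Plane => v 1) h
  simpa [h0, h1] using Real.sin_sq_add_cos_sq φ

theorem inner_eq_coordinates (u v : Plane) : inner ℝ u v = u 0 * v 0 + u 1 * v 1 := by
  simp only [PiLp.inner_apply, Fin.sum_univ_two, RCLike.inner_apply, conj_trivial]
  ring

/-- Lagrange's identity. -/
theorem cross_sq (u v : Plane) : cross u v ^ 2 = ‖u‖ ^ 2 * ‖v‖ ^ 2 - inner ℝ u v ^ 2 := by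
  rw [← real_inner_self_eq_norm_sq, ← real_inner_self_eq_norm_sq]
  simp only [inner_eq_coordinates, cross]
  ring

theorem exists_polar_angle (v : Plane) :
    ∃ φ ∈ Set.Ioc (-Real.pi) Real.pi, v = ‖v‖ • direction φ := by
  have hn : ‖(⟨v 0, v 1⟩ : ℂ)‖ = ‖v‖ := by
    rw [EuclideanSpace.norm_eq, Complex.norm_def, Complex.normSq_mk, Fin.sum_univ_two]
    simp only [Real.norm_eq_abs, abs_mul_abs_self, sq]
  refine ⟨Complex.arg ⟨v 0, v 1⟩, Complex.arg_mem_Ioc _, ?_⟩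
  ext i
  fin_cases i
  · simpa [direction, hn] using (Complex.norm_mul_cos_arg (⟨v 0, v 1⟩ : ℂ)).symm
  · simpa [direction, hn] using (Complex.norm_mul_sin_arg (⟨v 0, v 1⟩ : ℂ)).symm

theorem eq_smul_add_smul_of_cross_ne_zero {u w : Plane} (h : cross u w ≠ 0) (v : Plane) :
    v = (cross v w / cross u w) • u + (cross u v / cross u w) • w := by
  have key : ∀ i, v i = cross v w / cross u w * u i + cross u v / cross u w * w i := by
    intro i
    rw [div_mul_eq_mul_div, div_mul_eq_mul_div, ← add_div, eq_div_iff h]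
    fin_cases i <;> simp only [cross, Fin.zero_eta, Fin.mk_one] <;> ring
  ext i
  simpa using key i

/-- For unit vectors `u`, `w` at angle `θ`, a unit vector making an angle less than `θ / 2` with the
bisector `u + w` lies in the open cone spanned by `u` and `w`. -/
theorem coeff_pos_of_near_bisector {u w s v : Plane} (hu : ‖u‖ = 1) (hw : ‖w‖ = 1)
    (hv : ‖v‖ = 1) (h : cross u w ≠ 0) (hs : s = u + w) {a b : ℝ} (hab : v = a • u + b • w)
    (hlt : Real.cos (InnerProductGeometry.angle u w / 2) * ‖s‖ < inner ℝ v s) :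
    0 < a ∧ 0 < b := by
  set θ := InnerProductGeometry.angle u w
  set c : ℝ := inner ℝ u w with hc
  have huu : inner ℝ u u = (1 : ℝ) := by rw [real_inner_self_eq_norm_sq, hu]; norm_num
  have hww : inner ℝ w w = (1 : ℝ) := by rw [real_inner_self_eq_norm_sq, hw]; norm_num
  have hwu : inner ℝ w u = c := real_inner_comm _ _
  have hcos : Real.cos θ = c := by
    rw [InnerProductGeometry.cos_angle, hu, hw]; simp [hc]
  have hlag : cross u w ^ 2 = 1 - c ^ 2 := by rw [cross_sq, hu, hw, ← hc]; norm_num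
  have hpos : 0 < 1 - c ^ 2 := hlag ▸ by positivity
  have hc1 : 0 < 1 + c := by nlinarith
  have hc2 : 0 < 1 - c := by nlinarith
  have hss : ‖s‖ ^ 2 = 2 * (1 + c) := by
    rw [← real_inner_self_eq_norm_sq, hs]
    simp only [inner_add_left, inner_add_right, huu, hww, hwu, ← hc]; ring
  have hvs : inner ℝ v s = (a + b) * (1 + c) := by
    rw [hab, hs]
    simp only [inner_add_left, inner_add_right, real_inner_smul_left, huu, hww, hwu, ← hc]; ring
  have hvv : a ^ 2 + b ^ 2 + 2 * a * b * c = 1 := by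
    have : inner ℝ v v = (1 : ℝ) := by rw [real_inner_self_eq_norm_sq, hv]; norm_num
    rw [hab] at this
    simp only [inner_add_left, inner_add_right, real_inner_smul_left, real_inner_smul_right, huu,
      hww, hwu, ← hc] at this
    linarith
  have hhalf0 : 0 ≤ Real.cos (θ / 2) := Real.cos_nonneg_of_mem_Icc
    ⟨by linarith [InnerProductGeometry.angle_nonneg u w, Real.pi_pos],
      by linarith [InnerProductGeometry.angle_le_pi u w]⟩
  have hhalf : Real.cos (θ / 2) ^ 2 = (1 + c) / 2 := by
    rw [Real.cos_sq, mul_div_cancel₀ _ two_ne_zero, hcos]; ring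
  have hsq : (Real.cos (θ / 2) * ‖s‖) ^ 2 < ((a + b) * (1 + c)) ^ 2 := by
    rw [hvs] at hlt
    exact pow_lt_pow_left₀ hlt (by positivity) two_ne_zero
  rw [mul_pow, hhalf, hss] at hsq
  have hsum : 0 < a + b := by
    have : 0 < (a + b) * (1 + c) := hvs ▸ lt_of_le_of_lt (by positivity) hlt
    exact pos_of_mul_pos_left this hc1.le
  have h1 : 1 < (a + b) ^ 2 := by
    have : 0 < (1 + c) ^ 2 := by positivity
    nlinarith
  have hmul : 0 < a * b := by
    have : 0 < (a * b) * (1 - c) := by nlinarith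
    exact pos_of_mul_pos_left this hc2.le
  rcases mul_pos_iff.1 hmul with h | h
  · exact h
  · linarith [h.1, h.2]

theorem inner_direction (μ φ : ℝ) : inner ℝ (direction μ) (direction φ) = Real.cos (μ - φ) := by
  simp [direction, inner_eq_coordinates, Real.cos_sub]

theorem norm_direction (φ : ℝ) : ‖direction φ‖ = 1 := by
  have : ‖direction φ‖ ^ 2 = 1 := by
    rw [← real_inner_self_eq_norm_sq, inner_direction]; simp
  exact (sq_eq_sq₀ (norm_nonneg _) zero_le_one).1 (by simpa using this)

/-- The open cone spanned by two linearly independent vectors `u` and `w` contains an open sector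
whose opening is the angle between `u` and `w`; here `φ` is the polar angle of the bisector. -/
theorem exists_bisector {u w : Plane} (h : cross u w ≠ 0) :
    ∃ φ ∈ Set.Ioc (-Real.pi) Real.pi, ∀ μ, |μ - φ| < InnerProductGeometry.angle u w / 2 →
      ∃ a b : ℝ, 0 < a ∧ 0 < b ∧ direction μ = a • u + b • w := by
  have hu0 : u ≠ 0 := by rintro rfl; simp [cross] at h
  have hw0 : w ≠ 0 := by rintro rfl; simp [cross] at h
  have hup := norm_pos_iff.2 hu0
  have hwp := norm_pos_iff.2 hw0
  set u' := ‖u‖⁻¹ • u with hu'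
  set w' := ‖w‖⁻¹ • w with hw'
  have hang : InnerProductGeometry.angle u' w' = InnerProductGeometry.angle u w := by
    rw [hu', hw', InnerProductGeometry.angle_smul_left_of_pos _ _ (inv_pos.2 hup),
      InnerProductGeometry.angle_smul_right_of_pos _ _ (inv_pos.2 hwp)]
  have hcr : cross u' w' ≠ 0 := by
    have : cross u' w' = ‖u‖⁻¹ * ‖w‖⁻¹ * cross u w := by
      simp only [hu', hw', cross, PiLp.smul_apply, smul_eq_mul]; ring
    rw [this]; positivity
  have hs0 : u' + w' ≠ 0 := by
    intro h0
    apply hcr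
    rw [eq_neg_of_add_eq_zero_right h0]
    simp only [cross, PiLp.neg_apply]; ring
  obtain ⟨φ, hφ, hs⟩ := exists_polar_angle (u' + w')
  refine ⟨φ, hφ, fun μ hμ => ?_⟩
  have hdec := eq_smul_add_smul_of_cross_ne_zero hcr (direction μ)
  obtain ⟨ha, hb⟩ := coeff_pos_of_near_bisector (by rw [hu', norm_smul, norm_inv, norm_norm,
      inv_mul_cancel₀ hup.ne']) (by rw [hw', norm_smul, norm_inv, norm_norm,
      inv_mul_cancel₀ hwp.ne']) (norm_direction μ) hcr rfl hdec (by
    rw [hs, norm_smul, norm_norm, norm_direction, mul_one, real_inner_smul_right, inner_direction,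
      mul_comm, hang, ← Real.cos_abs (μ - φ)]
    refine mul_lt_mul_of_pos_left ?_ (norm_pos_iff.2 hs0)
    exact Real.cos_lt_cos_of_nonneg_of_le_pi (abs_nonneg _)
      (by linarith [InnerProductGeometry.angle_le_pi u w, Real.pi_pos]) hμ)
  refine ⟨_, _, mul_pos ha (inv_pos.2 hup), mul_pos hb (inv_pos.2 hwp), ?_⟩
  rw [mul_smul, mul_smul]
  exact hdec

/-- Points of `(-π, π]` at mutual distance at least `θ` are at most `⌈2π / θ⌉` in number: subdivide
`(-π, π]` into half-open intervals of length `θ`. -/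
theorem card_le_ceil_of_separated {ι : Type*} (F : Finset ι) (φ : ι → ℝ) {θ : ℝ} (hθ : 0 < θ)
    (hφ : ∀ i ∈ F, φ i ∈ Set.Ioc (-Real.pi) Real.pi)
    (hsep : ∀ i ∈ F, ∀ j ∈ F, i ≠ j → θ ≤ |φ i - φ j|) :
    (F.card : ℤ) ≤ ⌈2 * Real.pi / θ⌉ := by
  have hcard : F.card ≤ (Finset.Icc 1 ⌈2 * Real.pi / θ⌉).card := by
    refine Finset.card_le_card_of_injOn (fun i => ⌈(φ i + Real.pi) / θ⌉) (fun i hi => ?_) ?_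
    · have := hφ i hi
      simp only [Finset.coe_Icc, Set.mem_Icc]
      refine ⟨Int.one_le_ceil_iff.2 (div_pos (by linarith [this.1]) hθ), Int.ceil_le_ceil ?_⟩
      gcongr
      linarith [this.2]
    · intro i hi j hj hij
      by_contra hne
      have h1 := Int.le_ceil ((φ i + Real.pi) / θ)
      have h2 := Int.ceil_lt_add_one ((φ i + Real.pi) / θ)
      have h3 := Int.le_ceil ((φ j + Real.pi) / θ)
      have h4 := Int.ceil_lt_add_one ((φ j + Real.pi) / θ)
      simp only at hij
      rw [hij] at h1 h2
      have h5 : |(φ i + Real.pi) / θ - (φ j + Real.pi) / θ| < 1 := by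
        rw [abs_lt]; constructor <;> linarith
      rw [← sub_div, abs_div, abs_of_pos hθ, div_lt_one hθ] at h5
      have h6 := hsep i hi j hj hne
      rw [show φ i + Real.pi - (φ j + Real.pi) = φ i - φ j by ring] at h5
      linarith
  have hpos : 0 ≤ ⌈2 * Real.pi / θ⌉ := Int.ceil_nonneg (by positivity)
  rw [Int.card_Icc] at hcard
  omega

/-! ### Convex polygons -/

theorem mem_line_of_cross_eq_zero {p q x : Plane} (hpq : p ≠ q) (h : cross (q - p) (x - p) = 0) :
    x ∈ affineSpan ℝ {p, q} := by
  have hd : q - p ≠ 0 := sub_ne_zero.2 hpq.symm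
  obtain ⟨t, ht⟩ : ∃ t : ℝ, x - p = t • (q - p) := by
    simp only [cross] at h
    by_cases h0 : (q - p) 0 = 0
    · have h1 : (q - p) 1 ≠ 0 := by
        intro h1
        apply hd
        ext i
        fin_cases i
        · simpa using h0
        · simpa using h1
      refine ⟨(x - p) 1 / (q - p) 1, ?_⟩
      have h2 : (x - p) 0 = 0 := by
        rw [h0, zero_mul, zero_sub, neg_eq_zero] at h
        exact (mul_eq_zero.1 h).resolve_left h1
      ext i
      fin_cases i
      · change (x - p) 0 = _ * (q - p) 0
        rw [h0, h2, mul_zero]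
      · change (x - p) 1 = _ * (q - p) 1
        field_simp
    · refine ⟨(x - p) 0 / (q - p) 0, ?_⟩
      ext i
      fin_cases i
      · change (x - p) 0 = _ * (q - p) 0
        field_simp
      · change (x - p) 1 = _ * (q - p) 1
        field_simp
        linarith
  have : x = AffineMap.lineMap p q t := by
    rw [AffineMap.lineMap_apply_module', ← ht]; simp
  rw [this]
  exact AffineMap.lineMap_mem_affineSpan_pair t p q

theorem cross_eq_zero_of_mem_line {p q x : Plane} (h : x ∈ affineSpan ℝ {p, q}) :
    cross (q - p) (x - p) = 0 := by
  obtain ⟨t, rfl⟩ := mem_affineSpan_pair_iff_exists_lineMap_eq.1 h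
  simp only [cross, AffineMap.lineMap_apply_module', PiLp.sub_apply, PiLp.add_apply,
    PiLp.smul_apply, smul_eq_mul]
  ring

theorem cross_mul_cross_nonneg {p q x y : Plane} (h : (affineSpan ℝ {p, q}).WSameSide x y) :
    0 ≤ cross (q - p) (x - p) * cross (q - p) (y - p) := by
  obtain ⟨p₁, hp₁, p₂, hp₂, hray⟩ := h
  have e : ∀ z p' : Plane, p' ∈ affineSpan ℝ {p, q} →
      cross (q - p) (z - p) = cross (q - p) (z - p') := by
    intro z p' hp'
    have := cross_eq_zero_of_mem_line hp'
    simp only [cross, PiLp.sub_apply] at this ⊢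
    linarith
  rw [e x p₁ hp₁, e y p₂ hp₂]
  obtain ⟨z, a, b, ha, hb, -, hx, hy⟩ := hray.exists_eq_smul
  rw [vsub_eq_sub] at hx hy
  rw [hx, hy]
  have : cross (q - p) (a • z) * cross (q - p) (b • z) = a * b * cross (q - p) z ^ 2 := by
    simp only [cross, PiLp.smul_apply, smul_eq_mul]; ring
  rw [this]
  positivity

section Polygons

variable {n : ℕ} {P : Polygon Plane n}

theorem vertex_mem_region (i : Fin n) : P i ∈ region P := subset_convexHull ℝ _ ⟨i, rfl⟩

theorem isCompact_region : IsCompact (region P) := (Set.finite_range _).isCompact_convexHull ℝ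

theorem convex_region : Convex ℝ (region P) := convex_convexHull ℝ _

variable [NeZero n]

namespace IsConvexPolygon

theorem add_one_ne (hP : IsConvexPolygon P) (i : Fin n) : i + 1 ≠ i := by
  have h3 := hP.1
  intro h
  have h1 : (1 : Fin n) = 0 := by simpa using h
  have := congrArg Fin.val h1
  rw [Fin.val_zero, Fin.coe_ofNat_eq_mod, Nat.mod_eq_of_lt (by omega : 1 < n)] at this
  omega

theorem add_one_add_one_ne (hP : IsConvexPolygon P) (i : Fin n) : i + 1 + 1 ≠ i := by
  have h3 := hP.1
  intro h
  have h1 : (1 + 1 : Fin n) = 0 := by simpa [add_assoc] using h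
  have := congrArg Fin.val h1
  rw [Fin.val_add, Fin.val_zero, Fin.coe_ofNat_eq_mod, Nat.mod_eq_of_lt (by omega : 1 < n),
    Nat.mod_eq_of_lt (by omega)] at this
  omega

theorem sub_one_ne (hP : IsConvexPolygon P) (i : Fin n) : i - 1 ≠ i := fun h =>
  hP.add_one_ne (i - 1) (by rw [sub_add_cancel, h])

theorem sub_one_ne_add_one (hP : IsConvexPolygon P) (i : Fin n) : i - 1 ≠ i + 1 := fun h =>
  hP.add_one_add_one_ne (i - 1) (by rw [sub_add_cancel, h])

theorem vertex_notMem_side (hP : IsConvexPolygon P) {i j : Fin n} (hi : j ≠ i) (hi' : j ≠ i + 1) :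
    P j ∉ affineSpan ℝ {P i, P (i + 1)} :=
  (hP.2 i j j hi hi' hi hi').2.1

theorem vertex_ne (hP : IsConvexPolygon P) (i : Fin n) : P i ≠ P (i + 1) := fun h =>
  hP.vertex_notMem_side (hP.add_one_ne i).symm (hP.add_one_add_one_ne i).symm
    (h ▸ left_mem_affineSpan_pair ℝ _ _)

theorem cross_ne_zero (hP : IsConvexPolygon P) {i j : Fin n} (hi : j ≠ i) (hi' : j ≠ i + 1) :
    cross (P (i + 1) - P i) (P j - P i) ≠ 0 := fun h =>
  hP.vertex_notMem_side hi hi' (mem_line_of_cross_eq_zero (hP.vertex_ne i) h)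

/-- A linear functional that is constant on a side of a convex polygon and takes larger values at
the remaining vertices. -/
theorem exists_side_functional (hP : IsConvexPolygon P) (i : Fin n) :
    ∃ f : Plane →ₗ[ℝ] ℝ, f (P (i + 1)) = f (P i) ∧
      ∀ j, j ≠ i → j ≠ i + 1 → f (P i) < f (P j) := by
  set d := P (i + 1) - P i with hd
  -- the value at the next vertex fixes the sign
  set s := cross d (P (i + 1 + 1) - P i)
  let f : Plane →ₗ[ℝ] ℝ :=
    { toFun := fun x => s * cross d x
      map_add' := fun x y => by simp only [cross, PiLp.add_apply]; ring
      map_smul' := fun c x => by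
        simp only [cross, PiLp.smul_apply, smul_eq_mul, RingHom.id_apply]; ring }
  have hf : ∀ x y, f x - f y = s * cross d (x - y) := fun x y => by rw [← map_sub]; rfl
  have h1 := hP.add_one_add_one_ne i
  have h2 := hP.add_one_ne (i + 1)
  refine ⟨f, ?_, fun j hj hj' => ?_⟩
  · rw [← sub_eq_zero, hf, ← hd]
    simp only [cross]; ring
  · rw [← sub_pos, hf]
    exact lt_of_le_of_ne (cross_mul_cross_nonneg (hP.2 i _ j h1 h2 hj hj').1)
      (mul_ne_zero (hP.cross_ne_zero h1 h2) (hP.cross_ne_zero hj hj')).symm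

/-- A supporting functional at a vertex: the sum of those for the two sides that meet there. -/
theorem exists_vertex_functional (hP : IsConvexPolygon P) (k : Fin n) :
    ∃ f : Plane →ₗ[ℝ] ℝ, ∀ j, j ≠ k → f (P k) < f (P j) := by
  obtain ⟨f, hf, hf'⟩ := hP.exists_side_functional (k - 1)
  obtain ⟨g, hg, hg'⟩ := hP.exists_side_functional k
  rw [sub_add_cancel] at hf hf'
  refine ⟨f + g, fun j hj => ?_⟩
  rw [LinearMap.add_apply, LinearMap.add_apply]
  by_cases h1 : j = k - 1
  · subst h1
    have := hg' _ hj (hP.sub_one_ne_add_one k)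
    linarith
  · have hfj := hf' j h1 hj
    by_cases h2 : j = k + 1
    · subst h2
      linarith
    · linarith [hg' j hj h2]

theorem vertex_mem_extremePoints (hP : IsConvexPolygon P) (k : Fin n) :
    P k ∈ (region P).extremePoints ℝ := by
  obtain ⟨f, hf⟩ := hP.exists_vertex_functional k
  have hconv : Convex ℝ {x | x = P k ∨ f (P k) < f x} := by
    intro x hx y hy a b ha hb hab
    rcases ha.eq_or_lt with rfl | ha
    · obtain rfl : b = 1 := by simpa using hab
      simpa using hy
    rcases hb.eq_or_lt with rfl | hb
    · obtain rfl : a = 1 := by simpa using hab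
      simpa using hx
    obtain rfl : a = 1 - b := by linarith
    have hmap : f ((1 - b) • x + b • y) = (1 - b) * f x + b * f y := by simp
    rcases hx with rfl | hx
    · rcases hy with rfl | hy
      · left
        rw [← add_smul, hab, one_smul]
      · right
        rw [hmap]
        nlinarith
    · right
      have hy' : f (P k) ≤ f y := hy.elim (fun h => h ▸ le_rfl) le_of_lt
      rw [hmap]
      nlinarith
  have hsub : region P ⊆ {x | x = P k ∨ f (P k) < f x} := by
    refine convexHull_min ?_ hconv
    rintro _ ⟨j, rfl⟩
    by_cases h : j = k
    · exact Or.inl (h ▸ rfl)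
    · exact Or.inr (hf j h)
  rw [convex_region.mem_extremePoints_iff_convex_sdiff]
  refine ⟨vertex_mem_region k, ?_⟩
  have : region P \ {P k} = region P ∩ {x | f (P k) < f x} := by
    ext x
    refine and_congr_right fun hx => ⟨fun h => (hsub hx).resolve_left h, ?_⟩
    rintro h rfl
    exact lt_irrefl (f (P k)) h
  rw [this]
  exact convex_region.inter (convex_halfSpace_gt f.isLinear _)

theorem cross_sides_ne_zero (hP : IsConvexPolygon P) (i : Fin n) :
    cross (P (i - 1) - P i) (P (i + 1) - P i) ≠ 0 := by
  have := hP.cross_ne_zero (hP.sub_one_ne i) (hP.sub_one_ne_add_one i)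
  intro h
  apply this
  simp only [cross] at h ⊢
  linarith

theorem vertexAngle_pos (hP : IsConvexPolygon P) (i : Fin n) : 0 < vertexAngle P i := by
  refine lt_of_le_of_ne (InnerProductGeometry.angle_nonneg _ _) fun h => ?_
  obtain ⟨-, r, -, hr⟩ := InnerProductGeometry.angle_eq_zero_iff.1 h.symm
  apply hP.cross_sides_ne_zero i
  rw [vsub_eq_sub, vsub_eq_sub] at hr
  rw [hr]
  simp only [cross, PiLp.smul_apply, smul_eq_mul]; ring

end IsConvexPolygon

theorem minAngle_le (i : Fin n) : minAngle P ≤ vertexAngle P i :=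
  ciInf_le (Set.finite_range _).bddBelow i

theorem minAngle_le_pi : minAngle P ≤ Real.pi :=
  (minAngle_le 0).trans (InnerProductGeometry.angle_le_pi _ _)

theorem IsConvexPolygon.minAngle_pos (hP : IsConvexPolygon P) : 0 < minAngle P := by
  obtain ⟨i, hi⟩ := exists_eq_ciInf_of_finite (f := fun i : Fin n => vertexAngle P i)
  rw [minAngle, ← hi]
  exact hP.vertexAngle_pos i

end Polygons
/-! ### Similarities of the plane -/

/-- A similarity of the plane with positive ratio, which need not be contracting; unlike
contracting similarities, these include the map of the empty word. -/
def IsSimilarity (T : Plane → Plane) : Prop :=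
  ∃ r : ℝ, 0 < r ∧ ∀ x y, dist (T x) (T y) = r * dist x y

namespace IsSimilarity

variable {T : Plane → Plane}

theorem injective (hT : IsSimilarity T) : Function.Injective T := by
  obtain ⟨r, hr, h⟩ := hT
  intro x y hxy
  have := h x y
  rw [hxy, dist_self] at this
  exact dist_eq_zero.1 ((mul_eq_zero.1 this.symm).resolve_left hr.ne')

/-- A similarity is affine, with linear part a multiple of a linear isometry: after rescaling it is
an isometry into a strictly convex space. -/
theorem exists_linearIsometry (hT : IsSimilarity T) :
    ∃ (r : ℝ) (L : Plane →ₗᵢ[ℝ] Plane), 0 < r ∧ ∀ p v, T (p + v) = T p + r • L v := by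
  obtain ⟨r, hr, h⟩ := hT
  have hiso : Isometry fun x => r⁻¹ • T x := Isometry.of_dist_eq fun x y => by
    rw [dist_smul₀, h, norm_inv, Real.norm_of_nonneg hr.le, inv_mul_cancel_left₀ hr.ne']
  refine ⟨r, hiso.affineIsometryOfStrictConvexSpace.linearIsometry, hr, fun p v => ?_⟩
  have := hiso.affineIsometryOfStrictConvexSpace.map_vadd p v
  simp only [Isometry.coe_affineIsometryOfStrictConvexSpace, vadd_eq_add] at this
  rw [add_comm p v, ← smul_inv_smul₀ hr.ne' (T (v + p)), this, smul_add, smul_inv_smul₀ hr.ne',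
    add_comm]

theorem image_openSegment_subset (hT : IsSimilarity T) {x y z : Plane}
    (hz : z ∈ openSegment ℝ x y) : T z ∈ openSegment ℝ (T x) (T y) := by
  obtain ⟨r, L, -, h⟩ := hT.exists_linearIsometry
  rw [openSegment_eq_image'] at hz ⊢
  obtain ⟨t, ht, rfl⟩ := hz
  refine ⟨t, ht, ?_⟩
  have : T y = T x + r • L (y - x) := by rw [← h, add_sub_cancel]
  simp only
  rw [h, this, add_sub_cancel_left, map_smul, smul_comm]

end IsSimilarity

section Polygons

variable {n : ℕ} [NeZero n] {P : Polygon Plane n} {T : Plane → Plane}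

/-- If a similarity maps a convex polygon into itself, only vertices are mapped to vertices, since
vertices are the extreme points. -/
theorem IsConvexPolygon.eq_vertex_of_map_eq_vertex (hP : IsConvexPolygon P) (hT : IsSimilarity T)
    (hsub : T '' region P ⊆ region P) {y : Plane} (hy : y ∈ region P) {k : Fin n}
    (h : T y = P k) : ∃ l, y = P l := by
  have hext : y ∈ (region P).extremePoints ℝ := by
    refine mem_extremePoints_iff_left.2 ⟨hy, fun y₁ h₁ y₂ h₂ hseg => hT.injective ?_⟩
    rw [h]
    exact (mem_extremePoints_iff_left.1 (hP.vertex_mem_extremePoints k)).2 _ (hsub ⟨y₁, h₁, rfl⟩) _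
      (hsub ⟨y₂, h₂, rfl⟩) (h ▸ hT.image_openSegment_subset hseg)
  obtain ⟨l, hl⟩ := extremePoints_convexHull_subset hext
  exact ⟨l, hl.symm⟩

/-- The image of a convex polygon under a similarity contains, near the image of a vertex, a sector
whose opening is the vertex angle; here `φ` is the polar angle of its bisector. -/
theorem IsConvexPolygon.exists_sector (hP : IsConvexPolygon P) (hT : IsSimilarity T) (l : Fin n) :
    ∃ φ ∈ Set.Ioc (-Real.pi) Real.pi, ∀ μ, |μ - φ| < vertexAngle P l / 2 →
      ∃ ε > (0 : ℝ), ∀ t, 0 < t → t ≤ ε → T (P l) + t • direction μ ∈ T '' region P := by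
  obtain ⟨r, L, hr, hL⟩ := hT.exists_linearIsometry
  set u := P (l - 1) - P l with hu
  set w := P (l + 1) - P l with hw
  have hcross : cross (L u) (L w) ≠ 0 := by
    rw [← sq_pos_iff, cross_sq, L.norm_map, L.norm_map, L.inner_map_map, ← cross_sq,
      sq_pos_iff]
    exact hP.cross_sides_ne_zero l
  obtain ⟨φ, hφ, hsec⟩ := exists_bisector hcross
  refine ⟨φ, hφ, fun μ hμ => ?_⟩
  obtain ⟨a, b, ha, hb, hab⟩ := hsec μ (by rwa [L.angle_map])
  refine ⟨r / (a + b), by positivity, fun t ht htε => ?_⟩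
  -- the preimage is the convex combination of `P l` and its two neighbours with these weights
  refine ⟨P l + ((t * a / r) • u + (t * b / r) • w), ?_, ?_⟩
  · have hle : t * a / r + t * b / r ≤ 1 := by
      rw [← add_div, ← mul_add, div_le_one hr]
      exact (le_div_iff₀ (by positivity)).1 htε
    have hmem := convex_region.sum_mem (t := Finset.univ) (s := region P)
      (w := ![1 - (t * a / r + t * b / r), t * a / r, t * b / r])
      (z := ![P l, P (l - 1), P (l + 1)])
      (fun i _ => by
        fin_cases i
        · simpa using hle
        · change 0 ≤ t * a / r
          positivity
        · change 0 ≤ t * b / r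
          positivity)
      (by simp [Fin.sum_univ_three]; ring)
      (fun i _ => by fin_cases i <;> exact vertex_mem_region _)
    convert hmem using 1
    simp only [Fin.sum_univ_three, Matrix.cons_val]
    rw [hu, hw]
    module
  · rw [hL, hab, map_add, map_smul, map_smul, smul_add, smul_add, smul_smul, smul_smul, smul_smul,
      smul_smul, mul_div_cancel₀ _ hr.ne', mul_div_cancel₀ _ hr.ne']

end Polygons

/-! ### Words and pieces -/

section Systems

variable {n m : ℕ} [NeZero n] {P : Polygon Plane n} {S : Fin m → Plane → Plane} {K : Set Plane}

namespace IsPolygonalTreeSystem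

theorem isSimilarity_wordMap (hS : IsPolygonalTreeSystem P S) (w : List (Fin m)) :
    IsSimilarity (wordMap S w) := by
  induction w with
  | nil => exact ⟨1, one_pos, fun x y => by simp [wordMap]⟩
  | cons i w ih =>
    obtain ⟨r, hr, h⟩ := ih
    obtain ⟨q, hq, -, h'⟩ := hS.similarity i
    exact ⟨q * r, by positivity, fun x y => by
      rw [wordMap, Function.comp_apply, Function.comp_apply, h', h, mul_assoc]⟩

theorem injective (hS : IsPolygonalTreeSystem P S) (i : Fin m) : Function.Injective (S i) :=
  (hS.isSimilarity_wordMap [i]).injective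

theorem wordMap_image_subset (hS : IsPolygonalTreeSystem P S) (w : List (Fin m)) :
    wordMap S w '' region P ⊆ region P := by
  induction w with
  | nil => simp [wordMap]
  | cons i w ih =>
    rw [wordMap, Set.image_comp]
    exact (Set.image_mono ih).trans (hS.image_subset i)

theorem wordMap_mem_region (hS : IsPolygonalTreeSystem P S) (w : List (Fin m)) {y : Plane}
    (hy : y ∈ region P) : wordMap S w y ∈ region P :=
  hS.wordMap_image_subset w ⟨y, hy, rfl⟩

theorem attractor_subset (hS : IsPolygonalTreeSystem P S) (hK : IsAttractor S K) :
    K ⊆ region P := by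
  have hne : (region P).Nonempty := ⟨_, vertex_mem_region 0⟩
  -- the distance to the polygon attains its maximum on `K`, and each map of the system decreases it
  obtain ⟨x, hx, hmax⟩ := hK.compact.exists_isMaxOn hK.nonempty
    (Metric.continuous_infDist_pt (region P)).continuousOn
  have hle : ∀ y ∈ K, Metric.infDist y (region P) ≤ Metric.infDist x (region P) := hmax
  have hzero : Metric.infDist x (region P) = 0 := by
    have hx' := hx
    rw [hK.invariant] at hx'
    obtain ⟨i, y, hy, rfl⟩ := Set.mem_iUnion.1 hx'
    obtain ⟨r, hr0, hr1, hr⟩ := hS.similarity i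
    obtain ⟨z, hz, hyz⟩ := isCompact_region.exists_infDist_eq_dist hne y
    have h1 : Metric.infDist (S i y) (region P) ≤ r * Metric.infDist y (region P) := by
      rw [hyz, ← hr]
      exact Metric.infDist_le_dist_of_mem (hS.image_subset i ⟨z, hz, rfl⟩)
    have h2 := hle y hy
    have h3 := Metric.infDist_nonneg (x := S i y) (s := region P)
    have h4 := Metric.infDist_nonneg (x := y) (s := region P)
    nlinarith
  intro y hy
  rw [isCompact_region.isClosed.mem_iff_infDist_zero hne]
  exact le_antisymm (hzero ▸ hle y hy) Metric.infDist_nonneg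

/-- Pieces of the same generation that belong to different words have at most one common point, and
such a point is the image of a vertex for each of them. -/
theorem inter_pieces (hS : IsPolygonalTreeSystem P S) :
    ∀ {v w : List (Fin m)}, v.length = w.length → v ≠ w → ∀ x : Plane,
      x ∈ wordMap S v '' region P → x ∈ wordMap S w '' region P →
        (∃ l, x = wordMap S v (P l)) ∧
        ∀ y ∈ wordMap S v '' region P, y ∈ wordMap S w '' region P → y = x
  | [], [], _, hne => absurd rfl hne
  | i :: v, j :: w, hlen, hne => by
    intro x hxv hxw
    rw [wordMap, Set.image_comp] at hxv
    rw [wordMap, Set.image_comp] at hxw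
    rw [wordMap, wordMap, Set.image_comp, Set.image_comp]
    by_cases hij : i = j
    · subst hij
      obtain ⟨x', hxv, rfl⟩ := hxv
      rw [(hS.injective i).mem_set_image] at hxw
      obtain ⟨⟨l, hl⟩, huniq⟩ :=
        inter_pieces hS (by simpa using hlen) (by simpa using hne) x' hxv hxw
      refine ⟨⟨l, congrArg (S i) hl⟩, ?_⟩
      rintro _ ⟨y, hy, rfl⟩ hyw
      rw [(hS.injective i).mem_set_image] at hyw
      exact congrArg (S i) (huniq y hy hyw)
    · have hsub : ∀ y, y ∈ S i '' (wordMap S v '' region P) →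
          y ∈ S j '' (wordMap S w '' region P) →
          y ∈ S i '' region P ∩ S j '' region P := fun y hy hy' =>
        ⟨Set.image_mono (hS.wordMap_image_subset v) hy,
          Set.image_mono (hS.wordMap_image_subset w) hy'⟩
      rcases hS.inter i j hij with h | ⟨k, -, -, h⟩
      · exact absurd (h ▸ hsub x hxv hxw) (Set.notMem_empty x)
      · rw [h] at hsub
        have hx := hsub x hxv hxw
        refine ⟨?_, fun y hy hy' => (hsub y hy hy').trans hx.symm⟩
        rw [Set.mem_singleton_iff.1 hx, (hS.injective i).mem_set_image] at hxv
        obtain ⟨y, hy, hyk⟩ := hxv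
        obtain ⟨l, rfl⟩ := hS.convex.eq_vertex_of_map_eq_vertex (hS.isSimilarity_wordMap v)
          (hS.wordMap_image_subset v) hy hyk
        exact ⟨l, by rw [Function.comp_apply, hyk]; exact hx⟩

/-- At most `⌈2π / θ⌉` pieces of one generation, `θ` the smallest vertex angle, have a corner at
the same point: their sectors at that point do not overlap, so that the bisectors of any two of
these sectors are at an angle of at least `θ`. -/
theorem card_corners_le (hS : IsPolygonalTreeSystem P S) {x : Plane} {N : ℕ}
    (F : Finset (List (Fin m))) (hN : ∀ w ∈ F, w.length = N)
    (hF : ∀ w ∈ F, ∃ l, x = wordMap S w (P l)) :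
    (F.card : ℤ) ≤ ⌈2 * Real.pi / minAngle P⌉ := by
  have hsec : ∀ w : List (Fin m), ∃ φ : ℝ, w ∈ F → φ ∈ Set.Ioc (-Real.pi) Real.pi ∧
      ∀ μ, |μ - φ| < minAngle P / 2 →
        ∃ ε > (0 : ℝ), ∀ t, 0 < t → t ≤ ε → x + t • direction μ ∈ wordMap S w '' region P := by
    intro w
    by_cases hw : w ∈ F
    · obtain ⟨l, rfl⟩ := hF w hw
      obtain ⟨φ, hφ, h⟩ := hS.convex.exists_sector (hS.isSimilarity_wordMap w) l
      exact ⟨φ, fun _ => ⟨hφ, fun μ hμ => h μ (hμ.trans_le (by linarith [minAngle_le (P := P) l]))⟩⟩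
    · exact ⟨0, fun h => absurd h hw⟩
  choose φ hφ using hsec
  refine card_le_ceil_of_separated F φ hS.convex.minAngle_pos (fun w hw => (hφ w hw).1)
    fun v hv w hw hne => ?_
  by_contra! hlt
  -- the direction halfway between the two bisectors belongs to both sectors
  obtain ⟨ε, hε, h⟩ := (hφ v hv).2 ((φ v + φ w) / 2) (by
    rw [show (φ v + φ w) / 2 - φ v = -((φ v - φ w) / 2) by ring, abs_neg, abs_div, abs_two]
    linarith)
  obtain ⟨ε', hε', h'⟩ := (hφ w hw).2 ((φ v + φ w) / 2) (by
    rw [show (φ v + φ w) / 2 - φ w = (φ v - φ w) / 2 by ring, abs_div, abs_two]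
    linarith)
  set t := min ε ε'
  have ht : 0 < t := lt_min hε hε'
  have hx : ∀ u ∈ F, x ∈ wordMap S u '' region P := fun u hu => by
    obtain ⟨l, hl⟩ := hF u hu
    exact ⟨P l, vertex_mem_region l, hl.symm⟩
  have := (hS.inter_pieces ((hN v hv).trans (hN w hw).symm) hne x (hx v hv) (hx w hw)).2 _
    (h t ht (min_le_left _ _)) (h' t ht (min_le_right _ _))
  rw [add_eq_left, smul_eq_zero] at this
  exact this.elim ht.ne' (direction_ne_zero _)

end IsPolygonalTreeSystem

/-! ### Addresses -/

theorem length_initialWord (α : ℕ → Fin m) (k : ℕ) : (initialWord α k).length = k :=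
  List.length_ofFn

theorem eventually_initialWord_ne {α β : ℕ → Fin m} (h : α ≠ β) :
    ∀ᶠ k in Filter.atTop, initialWord α k ≠ initialWord β k := by
  obtain ⟨t, ht⟩ := Function.ne_iff.1 h
  filter_upwards [Filter.eventually_gt_atTop t] with k hk heq
  exact ht (congrFun (List.ofFn_injective heq) ⟨t, hk⟩)

namespace IsPolygonalTreeSystem

theorem mem_piece_of_addressMap_eq (hS : IsPolygonalTreeSystem P S) (hK : IsAttractor S K)
    {x : Plane} {α : ℕ → Fin m} (h : addressMap S K α = x) (k : ℕ) :
    x ∈ wordMap S (initialWord α k) '' region P := by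
  have hx : x ∈ ⋂ k, wordMap S (initialWord α k) '' K := by
    rw [iInter_eq_singleton_addressMap hS.similarity hK, h]; rfl
  exact Set.image_mono (hS.attractor_subset hK) (Set.mem_iInter.1 hx k)

theorem two_le_ceil (hS : IsPolygonalTreeSystem P S) : 2 ≤ ⌈2 * Real.pi / minAngle P⌉ := by
  have h0 := hS.convex.minAngle_pos
  have : (2 : ℝ) ≤ 2 * Real.pi / minAngle P := by
    rw [le_div_iff₀ h0]
    linarith [minAngle_le_pi (P := P)]
  exact_mod_cast this.trans (Int.le_ceil _)

/-- Several addresses of the same point have different initial words of some common length; then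
that point is a corner of each of the corresponding pieces. -/
theorem card_addresses_le (hS : IsPolygonalTreeSystem P S) (hK : IsAttractor S K) {x : Plane}
    (G : Finset (ℕ → Fin m)) (hG : ∀ α ∈ G, addressMap S K α = x) :
    (G.card : ℤ) ≤ ⌈2 * Real.pi / minAngle P⌉ := by
  rcases le_or_gt G.card 1 with h1 | h1
  · linarith [hS.two_le_ceil, (Nat.cast_le (α := ℤ)).2 h1]
  have hev : ∀ᶠ k in Filter.atTop, ∀ α ∈ G, ∀ β ∈ G, α ≠ β →
      initialWord α k ≠ initialWord β k := by
    refine (Filter.eventually_all_finset G).2 fun α _ =>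
      (Filter.eventually_all_finset G).2 fun β _ => ?_
    by_cases h : α = β
    · exact Filter.Eventually.of_forall fun _ h' => absurd h h'
    · exact (eventually_initialWord_ne h).mono fun _ hk _ => hk
  obtain ⟨N, hN⟩ := hev.exists
  have hinj : Set.InjOn (fun α => initialWord α N) (G : Set (ℕ → Fin m)) := by
    intro α hα β hβ h
    by_contra hne
    exact hN α hα β hβ hne h
  classical
  rw [← Finset.card_image_of_injOn hinj]
  refine hS.card_corners_le (x := x) (N := N) _ (fun w hw => ?_) fun w hw => ?_
  · obtain ⟨α, -, rfl⟩ := Finset.mem_image.1 hw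
    exact length_initialWord α N
  · obtain ⟨α, hα, rfl⟩ := Finset.mem_image.1 hw
    obtain ⟨β, hβ, hne⟩ := Finset.exists_mem_ne h1 α
    exact (hS.inter_pieces (by rw [length_initialWord, length_initialWord])
      (hN α hα β hβ hne.symm) x (hS.mem_piece_of_addressMap_eq hK (hG α hα) N)
      (hS.mem_piece_of_addressMap_eq hK (hG β hβ) N)).1

theorem finite_addresses (hS : IsPolygonalTreeSystem P S) (hK : IsAttractor S K) (x : Plane) :
    (addressMap S K ⁻¹' {x}).Finite := by
  by_contra hinf
  obtain ⟨G, hG, hcard⟩ := Set.Infinite.exists_subset_card_eq hinf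
    (⌈2 * Real.pi / minAngle P⌉.toNat + 1)
  have := hS.card_addresses_le hK G fun α hα => hG hα
  omega

theorem ncard_addresses_le (hS : IsPolygonalTreeSystem P S) (hK : IsAttractor S K) (x : Plane) :
    ((addressMap S K ⁻¹' {x}).ncard : ℤ) ≤ ⌈2 * Real.pi / minAngle P⌉ := by
  have hfin := hS.finite_addresses hK x
  rw [Set.ncard_eq_toFinset_card _ hfin]
  exact hS.card_addresses_le hK _ fun α hα => by simpa using hα

/-- The point of an address in the post-critical set is a vertex: a critical point lies in two
pieces of the first generation and hence is a corner of every such piece that contains it. -/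
theorem exists_addressMap_eq_vertex (hS : IsPolygonalTreeSystem P S) (hK : IsAttractor S K)
    {α : ℕ → Fin m} (hα : α ∈ postCriticalSet S K) : ∃ l, addressMap S K α = P l := by
  obtain ⟨w, hw, i, j, hij, hi, hj⟩ := hα
  have hy : addressMap S K α ∈ region P := by
    simpa [initialWord, wordMap] using hS.mem_piece_of_addressMap_eq hK (α := α) rfl 0
  have hsub := hS.attractor_subset hK
  obtain ⟨a, w, rfl⟩ := List.exists_cons_of_ne_nil hw
  obtain ⟨b, hab, hb⟩ : ∃ b, a ≠ b ∧
      wordMap S (a :: w) (addressMap S K α) ∈ S b '' region P := by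
    by_cases h : a = i
    · exact ⟨j, h ▸ hij, Set.image_mono hsub hj⟩
    · exact ⟨i, h, Set.image_mono hsub hi⟩
  obtain ⟨k, hk⟩ := (hS.inter_pieces (v := [a]) (w := [b]) rfl (by simpa using hab) _
    ⟨_, hS.wordMap_mem_region w hy, rfl⟩ hb).1
  exact hS.convex.eq_vertex_of_map_eq_vertex (hS.isSimilarity_wordMap w)
    (hS.wordMap_image_subset w) hy (hS.injective a hk)

theorem isPostCriticallyFinite (hS : IsPolygonalTreeSystem P S) (hK : IsAttractor S K) :
    IsPostCriticallyFinite S K := by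
  refine (Set.finite_iUnion fun l : Fin n => hS.finite_addresses hK (P l)).subset fun α hα => ?_
  obtain ⟨l, hl⟩ := hS.exists_addressMap_eq_vertex hK hα
  exact Set.mem_iUnion.2 ⟨l, hl⟩

end IsPolygonalTreeSystem

end Systems

end PolygonalTree

theorem corollary20 {n m : ℕ} [NeZero n] (P : Polygon PolygonalTree.Plane n)
    (S : Fin m → PolygonalTree.Plane → PolygonalTree.Plane)
    (hS : PolygonalTree.IsPolygonalTreeSystem P S)
    (K : Set PolygonalTree.Plane) (hK : PolygonalTree.IsAttractor S K) :
    (∀ x ∈ K, (PolygonalTree.addressMap S K ⁻¹' {x}).Finite ∧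
      ((PolygonalTree.addressMap S K ⁻¹' {x}).ncard : ℤ) ≤
        ((n : ℤ) - 1) * (⌈2 * Real.pi / PolygonalTree.minAngle P⌉ - 1)) ∧
    PolygonalTree.IsPostCriticallyFinite S K := by
  refine ⟨fun x _ => ⟨hS.finite_addresses hK x, (hS.ncard_addresses_le hK x).trans ?_⟩,
    hS.isPostCriticallyFinite hK⟩
  -- with `c = ⌈2π / θ⌉ ≥ 2` and `n ≥ 3`, `c ≤ 2 (c - 1) ≤ (n - 1) (c - 1)`
  have h2 := hS.two_le_ceil
  have h3 : (3 : ℤ) ≤ n := by exact_mod_cast hS.convex.1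
  nlinarith
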